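/- For a real number $q$ with $0\le q<1$ let $\exp_q$ be the deformed exponential $$\exp_q(x)=\bigl(1+(q-1)x\bigr)^{1/(q-1)},\qquad x<\frac{1}{1-q},$$ that is, the inverse function of the $q$-logarithm $\log_q(x)=\dfrac{x^{q-1}-1}{q-1}$, $x>0$. For a Hermitian matrix $A$ with spectrum in $(-\infty,1/(1-q))$ the matrix $\exp_q(A)$ is defined by the functional calculus; it is positive definite, and $\exp_q(A)^{2-q}$ denotes its power with real exponent $2-q$. **Theorem.** Let $0\le q<1$, and let $A$ and $B$ be negative definite (Hermitian) complex matrices of the same size. Then $$\operatorname{Tr}\,\exp_q(A+B)\;\le\;\operatorname{Tr}\Bigl[\exp_q(A)^{2-q}\bigl((q-1)A+\exp_q(B)\bigr)\Bigr].$$ -/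

import Mathlib

open scoped ComplexOrder

/-- The deformed exponential `exp_q`: `exp x` for `q = 1`, and `(x (q-1) + 1)^(1/(q-1))` for `q ≠ 1`.
It is the inverse of the `q`-logarithm `(x^(q-1) - 1)/(q-1)` on the domain `x (q-1) + 1 > 0`; this
domain is `x < 1/(1-q)` when `q < 1`, so it contains all negative numbers. Values outside the
domain carry no meaning. -/
noncomputable def qExp (q x : ℝ) : ℝ :=
  if q = 1 then Real.exp x else (x * (q - 1) + 1) ^ (1 / (q - 1))

/-- The matrix `exp_q(A)` of a Hermitian matrix `A`, by the functional calculus (every real function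
is continuous on the finite spectrum of `A`, so it applies to each Hermitian `A`). -/
noncomputable def Matrix.qExp {n : Type*} [Fintype n] [DecidableEq n]
    (q : ℝ) (A : Matrix n n ℂ) : Matrix n n ℂ :=
  cfc (_root_.qExp q) A

/-- The real power `X ^ s` of a positive definite matrix `X`, by the functional calculus. -/
noncomputable def Matrix.realPow {n : Type*} [Fintype n] [DecidableEq n]
    (X : Matrix n n ℂ) (s : ℝ) : Matrix n n ℂ :=
  cfc (fun x : ℝ => x ^ s) X

/-- A complex matrix is negative definite if it is Hermitian with `x* A x < 0` for all `x ≠ 0`. -/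
def Matrix.NegDef {n : Type*} [Fintype n] (A : Matrix n n ℂ) : Prop :=
  (-A).PosDef

/-! Put p = 1 - q, C = (q-1)A ≥ 0, D = (q-1)B + 1 > 0, M = C + D and W = C + 1. With Y = M^(-1/p)
and Z = D^(-1/p), the claim reads Tr Y ≤ Tr W^(-1/p-1)(C + Z). Every estimate below is tangent at B
= 0, where Z = 1, Y = V := W^(-1/p), and the claim is an equality.

Start from Tr Y = Tr Y^(1-p) M⁻¹. Splitting the identity as C W⁻¹ + W⁻¹ gives M⁻¹ ≤ W⁻¹ C W⁻¹ + W⁻¹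
D⁻¹ W⁻¹ (`posSemidef_sub_of_inverse_add`), where D⁻¹ = Z^p. Two tangent bounds follow. The scalar
one for y^(1-p) (`rpow_one_sub_le_tangent`) bounds Tr Y^(1-p) C W⁻² by p Tr C W^(-1/p-1) + (1-p) Tr
C W⁻¹ Y. The one for Lieb's jointly concave function Tr Z^p K Y^(1-p) K with K = W⁻¹
(`sum_rpow_mul_rpow_le_tangent`) gives p Tr W^(-1/p-1) Z + (1-p) Tr W⁻¹ Y. Since C W⁻¹ + W⁻¹ = 1,
the sum is p times the right-hand side plus (1-p) Tr Y. Subtract and divide by p.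

Lieb's tangent bound itself comes from an integral representation of x^p, which reduces it to
parallel sums and hence to a weighted triangle inequality. Traces are written throughout as sums
over eigenvalues weighted by squared overlaps of eigenvectors. -/

/-! ### Integral representation of powers and scalar tangent lines -/

open MeasureTheory Set in
/-- The integral representation of `x ^ p` together with the tangent lines of its integrand. -/
theorem exists_measure_rpow_eq_integral_tangent {p : ℝ} (hp : p ∈ Ioo (0 : ℝ) 1) :
    ∃ μ : Measure ℝ, (∀ x, 0 < x → IntegrableOn (fun t => t ^ (p - 1) * (x / (t + x))) (Ioi 0) μ ∧
        x ^ p = ∫ t in Ioi 0, t ^ (p - 1) * (x / (t + x)) ∂μ) ∧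
      ∀ v, 0 < v →
        IntegrableOn (fun t => t ^ (p - 1) * (t * v ^ 2 / (1 + t * v) ^ 2)) (Ioi 0) μ ∧
        IntegrableOn (fun t => t ^ (p - 1) * (1 / (1 + t * v) ^ 2)) (Ioi 0) μ ∧
        ∫ t in Ioi 0, t ^ (p - 1) * (t * v ^ 2 / (1 + t * v) ^ 2) ∂μ = p * v ^ (1 - p) ∧
        ∫ t in Ioi 0, t ^ (p - 1) * (1 / (1 + t * v) ^ 2) ∂μ = (1 - p) * v ^ (-p) := by
  obtain ⟨μ, hμ⟩ := Real.exists_measure_rpow_eq_integral_rpowIntegrand₀₁ hp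
  have hrep : ∀ x, 0 < x → IntegrableOn (fun t => t ^ (p - 1) * (x / (t + x))) (Ioi 0) μ ∧
        x ^ p = ∫ t in Ioi 0, t ^ (p - 1) * (x / (t + x)) ∂μ := by
    intro x hx
    obtain ⟨h1, h2⟩ := hμ x hx.le
    have he : EqOn (fun t => Real.rpowIntegrand₀₁ p t x)
        (fun t => t ^ (p - 1) * (x / (t + x))) (Ioi 0) := by
      intro t ht
      simp only
      rw [Real.rpowIntegrand₀₁_eq_pow_div hp (le_of_lt ht) hx.le, mul_div_assoc]
    exact ⟨h1.congr_fun he measurableSet_Ioi, h2.trans (setIntegral_congr_fun measurableSet_Ioi he)⟩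
  refine ⟨μ, hrep, fun v hv => ?_⟩
  have hv' : 0 < v⁻¹ := inv_pos.2 hv
  obtain ⟨hi, he⟩ := hrep v⁻¹ hv'
  have hI1 : IntegrableOn (fun t => t ^ (p - 1) * (t * v ^ 2 / (1 + t * v) ^ 2)) (Ioi 0) μ := by
    refine Integrable.mono' (hi.const_mul v) (Measurable.aestronglyMeasurable (by fun_prop)) ?_
    filter_upwards [ae_restrict_mem measurableSet_Ioi] with t (ht : 0 < t)
    rw [Real.norm_of_nonneg (by positivity), mul_left_comm]
    gcongr
    rw [show v * (v⁻¹ / (t + v⁻¹)) = v / (1 + t * v) by field_simp; ring,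
      div_le_div_iff₀ (by positivity) (by positivity)]
    have : 0 < t * v := by positivity
    nlinarith [mul_pos hv this, mul_pos (mul_pos hv this) this]
  have hI2 : IntegrableOn (fun t => t ^ (p - 1) * (1 / (1 + t * v) ^ 2)) (Ioi 0) μ := by
    refine Integrable.mono' hi (Measurable.aestronglyMeasurable (by fun_prop)) ?_
    filter_upwards [ae_restrict_mem measurableSet_Ioi] with t (ht : 0 < t)
    rw [Real.norm_of_nonneg (by positivity)]
    refine mul_le_mul_of_nonneg_left ?_ (by positivity)
    rw [show v⁻¹ / (t + v⁻¹) = 1 / (1 + t * v) by field_simp; ring]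
    have : 0 < t * v := by positivity
    exact one_div_le_one_div_of_le (by positivity) (by nlinarith)
  set a := ∫ t in Ioi 0, t ^ (p - 1) * (t * v ^ 2 / (1 + t * v) ^ 2) ∂μ with ha
  set b := ∫ t in Ioi 0, t ^ (p - 1) * (1 / (1 + t * v) ^ 2) ∂μ with hb
  -- For each t, the tangent line of x / (t + x) at x = v⁻¹ lies above it; the gap is a multiple of
  -- (xv - 1)².
  have hle : ∀ x, 0 < x → x ^ p ≤ x * a + b := by
    intro x hx
    obtain ⟨h1, h2⟩ := hrep x hx
    rw [h2, ha, hb, ← integral_const_mul, ← integral_add (hI1.const_mul x) hI2]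
    refine setIntegral_mono_on h1 ((hI1.const_mul x).add hI2) measurableSet_Ioi fun t ht => ?_
    have ht : 0 < t := ht
    rw [mul_left_comm, ← mul_add]
    gcongr
    rw [mul_div_assoc', ← add_div, div_le_div_iff₀ (by positivity) (by positivity)]
    nlinarith [mul_nonneg ht.le (sq_nonneg (x * v - 1))]
  have heq : (v⁻¹) ^ p = v⁻¹ * a + b := by
    rw [he, ha, hb, ← integral_const_mul, ← integral_add (hI1.const_mul _) hI2]
    refine setIntegral_congr_fun measurableSet_Ioi fun t ht => ?_
    have ht : 0 < t := ht
    rw [mul_left_comm, ← mul_add]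
    congr 1
    field_simp
    ring
  -- The line x * a + b lies above x ^ p and touches it at v⁻¹, so its slope is the derivative
  -- there. This evaluates both integrals without differentiating under the integral sign.
  have hder : a - p * v⁻¹ ^ (p - 1) = 0 := by
    have hmin : IsLocalMin (fun x : ℝ => x * a + b - x ^ p) v⁻¹ := by
      filter_upwards [Ioi_mem_nhds hv'] with x hx
      rw [heq]
      simpa using hle x hx
    refine hmin.hasDerivAt_eq_zero ?_
    have h1 := Real.hasDerivAt_rpow_const (x := v⁻¹) (p := p) (Or.inl hv'.ne')
    have h2 : HasDerivAt (fun x : ℝ => x * a + b - x ^ p) (1 * a - p * v⁻¹ ^ (p - 1)) v⁻¹ :=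
      (((hasDerivAt_id v⁻¹).mul_const a).add_const b).sub h1
    rwa [one_mul] at h2
  have ha' : a = p * v ^ (1 - p) := by
    rw [sub_eq_zero.1 hder, Real.inv_rpow hv.le, ← Real.rpow_neg hv.le, neg_sub]
  refine ⟨hI1, hI2, ha', ?_⟩
  have : v⁻¹ * v ^ (1 - p) = v ^ (-p) := by
    rw [← Real.rpow_neg_one, ← Real.rpow_add hv]; ring_nf
  rw [Real.inv_rpow hv.le, ← Real.rpow_neg hv.le, ha', mul_left_comm, this] at heq
  linarith

open MeasureTheory Set in
/-- Inequalities between weighted parallel sums integrate to inequalities between weighted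
geometric means. -/
theorem sum_rpow_mul_rpow_le_of_sum_parallel_le {ι κ : Type*} [Fintype ι] [Fintype κ]
    {p : ℝ} (hp : p ∈ Ioo (0 : ℝ) 1) {z y c : ι → ℝ} {v d e : κ → ℝ}
    (hz : ∀ i, 0 < z i) (hy : ∀ i, 0 < y i) (hv : ∀ k, 0 < v k)
    (h : ∀ t, 0 < t → ∑ i, c i * (z i * y i / (z i + t * y i)) ≤
      ∑ k, (d k * (t * v k ^ 2 / (1 + t * v k) ^ 2) + e k * (1 / (1 + t * v k) ^ 2))) :
    ∑ i, c i * (z i ^ p * y i ^ (1 - p)) ≤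
      ∑ k, (d k * (p * v k ^ (1 - p)) + e k * ((1 - p) * v k ^ (-p))) := by
  obtain ⟨μ, h1, h2⟩ := exists_measure_rpow_eq_integral_tangent hp
  have hx : ∀ i, 0 < z i / y i := fun i => div_pos (hz i) (hy i)
  -- By homogeneity, z^p y^(1-p) = y (z/y)^p.
  have hL : ∀ i, z i ^ p * y i ^ (1 - p) =
      y i * ∫ t in Ioi 0, t ^ (p - 1) * (z i / y i / (t + z i / y i)) ∂μ := by
    intro i
    rw [← (h1 _ (hx i)).2, Real.div_rpow (hz i).le (hy i).le, Real.rpow_sub (hy i), Real.rpow_one]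
    ring
  have hR : ∀ k, d k * (p * v k ^ (1 - p)) + e k * ((1 - p) * v k ^ (-p)) =
      ∫ t in Ioi 0, (d k * (t ^ (p - 1) * (t * v k ^ 2 / (1 + t * v k) ^ 2)) +
        e k * (t ^ (p - 1) * (1 / (1 + t * v k) ^ 2))) ∂μ := by
    intro k
    obtain ⟨i1, i2, e1, e2⟩ := h2 _ (hv k)
    rw [integral_add (i1.const_mul _) (i2.const_mul _), integral_const_mul, integral_const_mul,
      e1, e2]
  simp_rw [hL, hR, ← mul_assoc (c _), ← integral_const_mul]
  have iL : ∀ i, IntegrableOn (fun t => c i * y i * (t ^ (p - 1) * (z i / y i / (t + z i / y i))))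
      (Ioi 0) μ := fun i => (h1 _ (hx i)).1.const_mul _
  have iR : ∀ k, IntegrableOn (fun t => d k * (t ^ (p - 1) * (t * v k ^ 2 / (1 + t * v k) ^ 2)) +
        e k * (t ^ (p - 1) * (1 / (1 + t * v k) ^ 2))) (Ioi 0) μ := fun k =>
    ((h2 _ (hv k)).1.const_mul _).add ((h2 _ (hv k)).2.1.const_mul _)
  rw [← integral_finsetSum _ fun i _ => iL i, ← integral_finsetSum _ fun k _ => iR k]
  refine setIntegral_mono_on (integrable_finsetSum _ fun i _ => iL i)
    (integrable_finsetSum _ fun k _ => iR k) measurableSet_Ioi fun t ht => ?_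
  have ht : 0 < t := ht
  have := mul_le_mul_of_nonneg_left (h t ht) (Real.rpow_nonneg ht.le (p - 1))
  rw [Finset.mul_sum, Finset.mul_sum] at this
  convert this using 2 with i _ k _
  · have := hz i
    have := hy i
    field_simp
    ring
  · ring

/-- The tangent line inequality for a concave power function. -/
theorem rpow_one_sub_le_tangent {p y v : ℝ} (hp0 : 0 < p) (hp1 : p ≤ 1) (hy : 0 < y) (hv : 0 < v) :
    y ^ (1 - p) ≤ p * v ^ (1 - p) + (1 - p) * v ^ (-p) * y := by
  have h := Real.geom_mean_le_arith_mean2_weighted hp0.le (sub_nonneg.2 hp1) hv.le hy.le (by ring)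
  have h2 := mul_le_mul_of_nonneg_left h (Real.rpow_nonneg hv.le (-p))
  have e1 : v ^ (-p) * v ^ p = 1 := by rw [← Real.rpow_add hv]; simp
  have e2 : v ^ (-p) * v = v ^ (1 - p) := by
    nth_rw 2 [← Real.rpow_one v]
    rw [← Real.rpow_add hv]; ring_nf
  calc y ^ (1 - p) = v ^ (-p) * (v ^ p * y ^ (1 - p)) := by rw [← mul_assoc, e1, one_mul]
    _ ≤ _ := h2
    _ = p * (v ^ (-p) * v) + (1 - p) * v ^ (-p) * y := by ring
    _ = _ := by rw [e2]

/-! ### Spectral decompositions and traces as overlap sums -/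

namespace Matrix

variable {n : Type*} [Fintype n] [DecidableEq n]

/-- The matrix with real eigenvalues `a` and eigenvectors the columns of `P`. -/
noncomputable def conjDiag (P : unitaryGroup n ℂ) (a : n → ℝ) : Matrix n n ℂ :=
  (P : Matrix n n ℂ) * diagonal (fun i => (a i : ℂ)) * (P : Matrix n n ℂ)ᴴ

theorem unitaryGroup.conjTranspose_mul_self (P : unitaryGroup n ℂ) :
    (P : Matrix n n ℂ)ᴴ * (P : Matrix n n ℂ) = 1 :=
  Unitary.star_mul_self_of_mem P.2

theorem unitaryGroup.mul_conjTranspose_self (P : unitaryGroup n ℂ) :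
    (P : Matrix n n ℂ) * (P : Matrix n n ℂ)ᴴ = 1 :=
  Unitary.mul_star_self_of_mem P.2

variable (P Q R : unitaryGroup n ℂ)

theorem conjDiag_mul (a b : n → ℝ) :
    conjDiag P a * conjDiag P b = conjDiag P (fun i => a i * b i) := by
  unfold conjDiag
  calc _ = (P : Matrix n n ℂ) * diagonal (fun i => (a i : ℂ)) *
        ((P : Matrix n n ℂ)ᴴ * (P : Matrix n n ℂ)) * diagonal (fun i => (b i : ℂ)) *
        (P : Matrix n n ℂ)ᴴ := by simp only [mul_assoc]
    _ = _ := by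
      rw [unitaryGroup.conjTranspose_mul_self, mul_one, mul_assoc (P : Matrix n n ℂ),
        diagonal_mul_diagonal]
      simp

theorem conjDiag_add (a b : n → ℝ) :
    conjDiag P a + conjDiag P b = conjDiag P (fun i => a i + b i) := by
  simp [conjDiag, ← add_mul, ← mul_add, diagonal_add]

theorem conjDiag_smul (c : ℝ) (a : n → ℝ) :
    (c : ℂ) • conjDiag P a = conjDiag P (fun i => c * a i) := by
  unfold conjDiag
  rw [← smul_mul_assoc, ← mul_smul_comm, ← diagonal_smul]
  congr
  ext i
  simp

theorem conjDiag_one : conjDiag P (fun _ => 1) = 1 := by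
  simp [conjDiag, unitaryGroup.mul_conjTranspose_self]

theorem conjDiag_conjTranspose (a : n → ℝ) : (conjDiag P a)ᴴ = conjDiag P a := by
  unfold conjDiag
  simp only [conjTranspose_mul, conjTranspose_conjTranspose, diagonal_conjTranspose, mul_assoc]
  congr
  ext i
  simp

theorem posSemidef_conjDiag {a : n → ℝ} (ha : ∀ i, 0 ≤ a i) : (conjDiag P a).PosSemidef := by
  refine PosSemidef.mul_mul_conjTranspose_same (PosSemidef.diagonal fun i => ?_) _
  simpa using ha i

theorem IsHermitian.exists_cfc_eq_conjDiag {A : Matrix n n ℂ} (hA : A.IsHermitian) :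
    ∃ (P : unitaryGroup n ℂ) (a : n → ℝ), ∀ f : ℝ → ℝ, cfc f A = conjDiag P (fun i => f (a i)) :=
  ⟨hA.eigenvectorUnitary, hA.eigenvalues, fun f => by
    rw [hA.cfc_eq, IsHermitian.cfc, Unitary.conjStarAlgAut_apply]
    rfl⟩

theorem NegDef.exists_cfc_eq_conjDiag {A : Matrix n n ℂ} (hA : A.NegDef) :
    ∃ (P : unitaryGroup n ℂ) (a : n → ℝ), A = conjDiag P a ∧ (∀ i, a i < 0) ∧
      ∀ f : ℝ → ℝ, cfc f A = conjDiag P (fun i => f (a i)) := by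
  have hH : A.IsHermitian := by
    have := hA.isHermitian.neg
    rwa [neg_neg] at this
  obtain ⟨P, a, h⟩ := hH.exists_cfc_eq_conjDiag
  have hAP : A = conjDiag P a := (cfc_id' ℝ A hH.isSelfAdjoint).symm.trans (h _)
  refine ⟨P, a, hAP, fun i => ?_, h⟩
  have hinj : Function.Injective (P : Matrix n n ℂ).mulVec :=
    mulVec_injective_of_isUnit ⟨⟨P, (P : Matrix n n ℂ)ᴴ, unitaryGroup.mul_conjTranspose_self P,
      unitaryGroup.conjTranspose_mul_self P⟩, rfl⟩
  have hpos := (PosDef.conjTranspose_mul_mul_same hA hinj).diag_pos (i := i)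
  have he : (P : Matrix n n ℂ)ᴴ * -A * (P : Matrix n n ℂ) =
      -diagonal (fun i => (a i : ℂ)) := by
    rw [hAP, conjDiag, mul_neg, neg_mul, ← mul_assoc, ← mul_assoc,
      unitaryGroup.conjTranspose_mul_self, one_mul, mul_assoc,
      unitaryGroup.conjTranspose_mul_self, mul_one]
  rw [he, neg_apply, diagonal_apply_eq, neg_pos, ← Complex.ofReal_zero,
    Complex.real_lt_real] at hpos
  exact hpos

theorem trace_conjDiag (a : n → ℝ) : (conjDiag P a).trace = ((∑ i, a i : ℝ) : ℂ) := by
  rw [conjDiag, trace_mul_cycle, unitaryGroup.conjTranspose_mul_self, one_mul, trace_diagonal]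
  simp

theorem trace_conjDiag_mul (a : n → ℝ) (E : Matrix n n ℂ) :
    (conjDiag P a * E).trace =
      ∑ i, (a i : ℂ) * ((P : Matrix n n ℂ)ᴴ * E * (P : Matrix n n ℂ)) i i := by
  rw [conjDiag, mul_assoc, mul_assoc, trace_mul_comm, mul_assoc]
  simp [trace, diagonal_mul, mul_assoc]

theorem trace_conjDiag_mul_mul_conjDiag_mul (z y : n → ℝ) (K : Matrix n n ℂ) :
    (conjDiag Q z * (K * conjDiag R y * Kᴴ)).trace =
      ((∑ j, ∑ k, z j * y k * ‖((Q : Matrix n n ℂ)ᴴ * K * (R : Matrix n n ℂ)) j k‖ ^ 2 : ℝ) : ℂ) := by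
  rw [trace_conjDiag_mul]
  push_cast
  refine Finset.sum_congr rfl fun j _ => ?_
  have : (Q : Matrix n n ℂ)ᴴ * (K * conjDiag R y * Kᴴ) * (Q : Matrix n n ℂ) =
      ((Q : Matrix n n ℂ)ᴴ * K * (R : Matrix n n ℂ)) * diagonal (fun i => (y i : ℂ)) *
      ((Q : Matrix n n ℂ)ᴴ * K * (R : Matrix n n ℂ))ᴴ := by
    simp [conjDiag, mul_assoc]
  rw [this, mul_apply, Finset.mul_sum]
  refine Finset.sum_congr rfl fun k _ => ?_
  rw [mul_diagonal, conjTranspose_apply, ← Complex.mul_conj']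
  simp only [RCLike.star_def]
  ring

theorem trace_conjDiag_mul_conjDiag (a b : n → ℝ) :
    (conjDiag P a * conjDiag Q b).trace =
      ((∑ i, ∑ j, a i * b j * ‖((P : Matrix n n ℂ)ᴴ * (Q : Matrix n n ℂ)) i j‖ ^ 2 : ℝ) : ℂ) := by
  simpa using trace_conjDiag_mul_mul_conjDiag_mul P Q a b 1

/-! ### Tangent planes of Lieb's concave trace function -/

/-- A weighted form of the triangle inequality, with the parallel sum of the weights. -/
theorem _root_.norm_add_sq_mul_parallel_le {E : Type*} [SeminormedAddCommGroup E] (x y : E)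
    {a b : ℝ} (ha : 0 < a) (hb : 0 < b) :
    a * b / (a + b) * ‖x + y‖ ^ 2 ≤ a * ‖x‖ ^ 2 + b * ‖y‖ ^ 2 := by
  have h : ‖x + y‖ ^ 2 ≤ (‖x‖ + ‖y‖) ^ 2 := by gcongr; exact norm_add_le x y
  calc a * b / (a + b) * ‖x + y‖ ^ 2 ≤ a * b / (a + b) * (‖x‖ + ‖y‖) ^ 2 := by gcongr
    _ ≤ _ := by
      rw [div_mul_eq_mul_div, div_le_iff₀ (by positivity)]
      nlinarith [sq_nonneg (a * ‖x‖ - b * ‖y‖)]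

/-- The weighted triangle inequality applies to each entry of Q*K₁R + Q*K₂R with weights z j and y
k. Unitarity of R, respectively Q, then collapses the two sums to Tr Z K₁² and Tr Y K₂². -/
theorem sum_parallel_le (z y k₁ k₂ : n → ℝ) (hz : ∀ i, 0 < z i) (hy : ∀ i, 0 < y i) :
    ∑ j, ∑ k, z j * y k / (z j + y k) *
      ‖((Q : Matrix n n ℂ)ᴴ * conjDiag P (fun i => k₁ i + k₂ i) * (R : Matrix n n ℂ)) j k‖ ^ 2 ≤
    ∑ i, (k₁ i ^ 2 * ∑ j, z j * ‖((P : Matrix n n ℂ)ᴴ * (Q : Matrix n n ℂ)) i j‖ ^ 2 +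
      k₂ i ^ 2 * ∑ k, y k * ‖((P : Matrix n n ℂ)ᴴ * (R : Matrix n n ℂ)) i k‖ ^ 2) := by
  have e1 : ∑ j, ∑ k, z j *
      ‖((Q : Matrix n n ℂ)ᴴ * conjDiag P k₁ * (R : Matrix n n ℂ)) j k‖ ^ 2 =
      ∑ i, k₁ i ^ 2 * ∑ j, z j * ‖((P : Matrix n n ℂ)ᴴ * (Q : Matrix n n ℂ)) i j‖ ^ 2 := by
    have h1 := trace_conjDiag_mul_mul_conjDiag_mul Q R z (fun _ => 1) (conjDiag P k₁)
    rw [conjDiag_one, mul_one, conjDiag_conjTranspose, conjDiag_mul, trace_mul_comm,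
      trace_conjDiag_mul_conjDiag, Complex.ofReal_inj] at h1
    simp only [mul_one] at h1
    rw [← h1]
    refine Finset.sum_congr rfl fun i _ => ?_
    rw [Finset.mul_sum]
    refine Finset.sum_congr rfl fun j _ => ?_
    ring
  have e2 : ∑ j, ∑ k, y k *
      ‖((Q : Matrix n n ℂ)ᴴ * conjDiag P k₂ * (R : Matrix n n ℂ)) j k‖ ^ 2 =
      ∑ i, k₂ i ^ 2 * ∑ k, y k * ‖((P : Matrix n n ℂ)ᴴ * (R : Matrix n n ℂ)) i k‖ ^ 2 := by
    have h1 := trace_conjDiag_mul_mul_conjDiag_mul Q R (fun _ => 1) y (conjDiag P k₂)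
    rw [conjDiag_one, one_mul, trace_mul_comm, conjDiag_conjTranspose, ← mul_assoc, conjDiag_mul,
      trace_conjDiag_mul_conjDiag, Complex.ofReal_inj] at h1
    simp only [one_mul] at h1
    rw [← h1]
    refine Finset.sum_congr rfl fun i _ => ?_
    rw [Finset.mul_sum]
    refine Finset.sum_congr rfl fun j _ => ?_
    ring
  rw [Finset.sum_add_distrib, ← e1, ← e2, ← Finset.sum_add_distrib]
  refine Finset.sum_le_sum fun j _ => ?_
  rw [← Finset.sum_add_distrib]
  refine Finset.sum_le_sum fun k _ => ?_
  rw [← conjDiag_add, mul_add, add_mul, add_apply]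
  exact norm_add_sq_mul_parallel_le _ _ (hz j) (hy k)

/-- The tangent plane inequality for the jointly concave function
`(Z, Y) ↦ tr (Z ^ p * K * Y ^ (1 - p) * K)` of positive matrices, at a point `(1, V)` where
`V` commutes with `K`. -/
theorem sum_rpow_mul_rpow_le_tangent {p : ℝ} (hp0 : 0 < p) (hp1 : p ≤ 1) {z y κ v : n → ℝ}
    (hz : ∀ i, 0 < z i) (hy : ∀ i, 0 < y i) (hv : ∀ i, 0 < v i) :
    ∑ j, ∑ k, z j ^ p * y k ^ (1 - p) *
      ‖((Q : Matrix n n ℂ)ᴴ * conjDiag P κ * (R : Matrix n n ℂ)) j k‖ ^ 2 ≤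
    ∑ i, (κ i ^ 2 * (p * v i ^ (1 - p)) *
        ∑ j, z j * ‖((P : Matrix n n ℂ)ᴴ * (Q : Matrix n n ℂ)) i j‖ ^ 2 +
      κ i ^ 2 * ((1 - p) * v i ^ (-p)) *
        ∑ k, y k * ‖((P : Matrix n n ℂ)ᴴ * (R : Matrix n n ℂ)) i k‖ ^ 2) := by
  -- The integral representation needs p < 1; at p = 1 both sides equal Tr Z K².
  rcases hp1.eq_or_lt with rfl | hp1
  · have h1 := trace_conjDiag_mul_mul_conjDiag_mul Q R z (fun _ => 1) (conjDiag P κ)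
    rw [conjDiag_one, mul_one, conjDiag_conjTranspose, conjDiag_mul, trace_mul_comm,
      trace_conjDiag_mul_conjDiag, Complex.ofReal_inj] at h1
    simp only [mul_one] at h1
    simp only [Real.rpow_one, sub_self, Real.rpow_zero, mul_one, zero_mul, mul_zero, add_zero]
    rw [← h1]
    refine (Finset.sum_congr rfl fun i _ => ?_).le
    rw [Finset.mul_sum]
    refine Finset.sum_congr rfl fun j _ => ?_
    ring
  have hmain := sum_rpow_mul_rpow_le_of_sum_parallel_le (ι := n × n) (κ := n) (p := p) ⟨hp0, hp1⟩
    (z := fun i => z i.1) (y := fun i => y i.2) (v := v)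
    (c := fun i => ‖((Q : Matrix n n ℂ)ᴴ * conjDiag P κ * (R : Matrix n n ℂ)) i.1 i.2‖ ^ 2)
    (d := fun i => κ i ^ 2 * ∑ j, z j * ‖((P : Matrix n n ℂ)ᴴ * (Q : Matrix n n ℂ)) i j‖ ^ 2)
    (e := fun i => κ i ^ 2 * ∑ k, y k * ‖((P : Matrix n n ℂ)ᴴ * (R : Matrix n n ℂ)) i k‖ ^ 2)
    (fun i => hz _) (fun i => hy _) hv ?_
  · rw [Fintype.sum_prod_type] at hmain
    refine le_of_eq_of_le ?_ (hmain.trans_eq ?_)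
    · exact Finset.sum_congr rfl fun j _ => Finset.sum_congr rfl fun k _ => mul_comm _ _
    · exact Finset.sum_congr rfl fun i _ => by ring
  · intro t ht
    -- κ is split in the ratio t v : 1, which gives equality in the weighted triangle inequality for
    -- the weights 1 and t v, that is, at the point of tangency (1, V).
    have h := sum_parallel_le P Q R z (fun k => t * y k) (fun i => κ i * (t * v i) / (1 + t * v i))
      (fun i => κ i / (1 + t * v i)) hz (fun k => mul_pos ht (hy k))
    have hκ : (fun i => κ i * (t * v i) / (1 + t * v i) + κ i / (1 + t * v i)) = κ := by
      ext i
      have := mul_pos ht (hv i)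
      field_simp
      ring
    rw [hκ] at h
    rw [Fintype.sum_prod_type]
    refine le_of_mul_le_mul_left ?_ ht
    refine le_of_eq_of_le ?_ (h.trans_eq ?_)
    · rw [Finset.mul_sum]
      refine Finset.sum_congr rfl fun j _ => ?_
      rw [Finset.mul_sum]
      refine Finset.sum_congr rfl fun k _ => ?_
      ring
    · rw [Finset.mul_sum]
      refine Finset.sum_congr rfl fun i _ => ?_
      have := mul_pos ht (hv i)
      simp_rw [mul_assoc t, ← Finset.mul_sum]
      field_simp
-- Operator bound for the inverse of a sum, and the trace inequality
/-- If `N` is the inverse of `C + D`, then the form `x ↦ ⟪x, N x⟫` is at most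
`⟪C U x, C⁻¹ C U x⟫ + ⟪U x, D⁻¹ U x⟫` where `U` is the inverse of `C + 1`. -/
theorem posSemidef_sub_of_inverse_add {C D D' N U : Matrix n n ℂ} (hC : C.PosSemidef)
    (hD' : D'.PosSemidef) (hDh : Dᴴ = D) (hN : Nᴴ = N) (hU : Uᴴ = U) (hDD : D * D' = 1)
    (hCDN : (C + D) * N = 1) (hUC : U * (C + 1) = 1) :
    (U * C * U + U * D' * U - N).PosSemidef := by
  have hDD' : D' * D = 1 := mul_eq_one_comm.1 hDD
  have hCU : (C + 1) * U = 1 := mul_eq_one_comm.1 hUC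
  -- The optimal splitting of x is C N x + D N x, the one used is C U x + U x. The difference of the
  -- two energies is a sum of two squares, written so that C need not be invertible.
  have h1 : ((N - U)ᴴ * C * (N - U)).PosSemidef := hC.conjTranspose_mul_mul_same _
  have h2 : ((D * N - U)ᴴ * D' * (D * N - U)).PosSemidef := hD'.conjTranspose_mul_mul_same _
  have h3 := h1.add h2
  rw [conjTranspose_sub, conjTranspose_sub, conjTranspose_mul, hN, hU, hDh] at h3
  convert h3 using 1
  have a1 : N * ((C + D) * N) = N := by rw [hCDN, mul_one]
  have a2 : U * (C + 1) * N = N := by rw [hUC, one_mul]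
  have a3 : N * ((C + 1) * U) = N := by rw [hCU, mul_one]
  have e1 : N * D * D' * (D * N) = N * D * N := by
    rw [mul_assoc (N * D), ← mul_assoc D', hDD', one_mul]
  have e2 : N * D * D' * U = N * U := by rw [mul_assoc N, hDD, mul_one]
  have e3 : U * D' * (D * N) = U * N := by rw [mul_assoc U, ← mul_assoc D', hDD', one_mul]
  have : (N - U) * C * (N - U) + (N * D - U) * D' * (D * N - U) =
      (N * ((C + D) * N) - U * (C + 1) * N - N * ((C + 1) * U) + U * C * U + U * D' * U) +
      (N * D * D' * (D * N) - N * D * N) - (N * D * D' * U - N * U) -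
      (U * D' * (D * N) - U * N) := by
    noncomm_ring
  rw [this, a1, a2, a3, e1, e2, e3]
  abel

/-- This is the preceding operator inequality traced against the positive semidefinite matrix with
eigenvalues `y`, which shares the eigenbasis R of C + D. -/
theorem sum_div_le_of_conjDiag_add {c d m y u : n → ℝ} (hc : ∀ i, 0 ≤ c i) (hd : ∀ i, 0 < d i)
    (hm : ∀ i, 0 < m i) (hu : ∀ i, u i * (c i + 1) = 1) (hy : ∀ i, 0 ≤ y i)
    (h : conjDiag P c + conjDiag Q d = conjDiag R m) :
    ∑ k, y k / m k ≤
      ∑ i, ∑ k, c i * u i ^ 2 * y k * ‖((P : Matrix n n ℂ)ᴴ * (R : Matrix n n ℂ)) i k‖ ^ 2 +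
      ∑ j, ∑ k, (d j)⁻¹ * y k *
        ‖((Q : Matrix n n ℂ)ᴴ * conjDiag P u * (R : Matrix n n ℂ)) j k‖ ^ 2 := by
  have hE := posSemidef_sub_of_inverse_add (C := conjDiag P c) (D := conjDiag Q d)
    (D' := conjDiag Q fun i => (d i)⁻¹) (N := conjDiag R fun i => (m i)⁻¹) (U := conjDiag P u)
    (posSemidef_conjDiag P hc) (posSemidef_conjDiag Q fun i => (inv_pos.2 (hd i)).le)
    (conjDiag_conjTranspose _ _) (conjDiag_conjTranspose _ _) (conjDiag_conjTranspose _ _)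
    (by simp [conjDiag_mul, (hd _).ne', conjDiag_one])
    (by simp [h, conjDiag_mul, (hm _).ne', conjDiag_one])
    (by rw [← conjDiag_one P, conjDiag_add, conjDiag_mul]; simp [hu])
  have ht : 0 ≤ (conjDiag R y * (conjDiag P u * conjDiag P c * conjDiag P u +
      conjDiag P u * conjDiag Q (fun i => (d i)⁻¹) * conjDiag P u -
      conjDiag R fun i => (m i)⁻¹)).trace := by
    rw [trace_conjDiag_mul]
    refine Finset.sum_nonneg fun i _ => mul_nonneg ?_
      (hE.conjTranspose_mul_mul_same (R : Matrix n n ℂ)).diag_nonneg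
    rw [← Complex.ofReal_zero, Complex.real_le_real]
    exact hy i
  have e2 : (conjDiag R y * (conjDiag P u * conjDiag Q (fun i => (d i)⁻¹) * conjDiag P u)).trace =
      (conjDiag Q (fun i => (d i)⁻¹) * (conjDiag P u * conjDiag R y * (conjDiag P u)ᴴ)).trace := by
    rw [conjDiag_conjTranspose, trace_mul_comm, mul_assoc, mul_assoc, trace_mul_comm]
    simp only [mul_assoc]
  rw [mul_sub, mul_add, trace_sub, trace_add, e2, trace_conjDiag_mul_mul_conjDiag_mul,
    conjDiag_mul, conjDiag_mul, trace_mul_comm, trace_conjDiag_mul_conjDiag, conjDiag_mul,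
    trace_conjDiag, ← Complex.ofReal_add, ← Complex.ofReal_sub, ← Complex.ofReal_zero,
    Complex.real_le_real, sub_nonneg] at ht
  convert ht using 5 with i _ k
  all_goals ring

/-- The trace inequality in terms of eigenvalues and of the overlaps of eigenvectors. -/
theorem sum_rpow_le_of_conjDiag_add {p : ℝ} (hp0 : 0 < p) (hp1 : p ≤ 1) {c d m : n → ℝ}
    (hc : ∀ i, 0 ≤ c i) (hd : ∀ i, 0 < d i) (hm : ∀ i, 0 < m i)
    (h : conjDiag P c + conjDiag Q d = conjDiag R m) :
    ∑ k, m k ^ (-p⁻¹) ≤ ∑ i, (c i + 1) ^ (-p⁻¹ - 1) *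
      (c i + ∑ j, d j ^ (-p⁻¹) * ‖((P : Matrix n n ℂ)ᴴ * (Q : Matrix n n ℂ)) i j‖ ^ 2) := by
  have hw : ∀ i, 0 < c i + 1 := fun i => by linarith [hc i]
  have hpow : ∀ x : ℝ, 0 < x → (x ^ (-p⁻¹)) ^ p = x⁻¹ := fun x hx => by
    rw [← Real.rpow_mul hx.le, neg_mul, inv_mul_cancel₀ hp0.ne', Real.rpow_neg_one]
  have hpow' : ∀ x : ℝ, 0 < x → (x ^ (-p⁻¹)) ^ (-p) = x := fun x hx => by
    rw [← Real.rpow_mul hx.le, neg_mul_neg, inv_mul_cancel₀ hp0.ne', Real.rpow_one]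
  have hpow1 : ∀ x : ℝ, 0 < x → (x ^ (-p⁻¹)) ^ (1 - p) = x ^ (-p⁻¹) * x := fun x hx => by
    rw [sub_eq_add_neg, Real.rpow_add (Real.rpow_pos_of_pos hx _), Real.rpow_one, hpow' x hx]
  have hw1 : ∀ i, (c i + 1) ^ (-p⁻¹ - 1) = (c i + 1) ^ (-p⁻¹) * (c i + 1)⁻¹ := fun i => by
    rw [sub_eq_add_neg, Real.rpow_add (hw i), Real.rpow_neg_one]
  have hY : ∀ k, 0 < m k ^ (-p⁻¹) := fun k => Real.rpow_pos_of_pos (hm k) _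
  have hV : ∀ i, 0 < (c i + 1) ^ (-p⁻¹) := fun i => Real.rpow_pos_of_pos (hw i) _
  set T : n → n → ℝ := fun i k => ‖((P : Matrix n n ℂ)ᴴ * (R : Matrix n n ℂ)) i k‖ ^ 2 with hT
  set η : n → ℝ := fun i => ∑ k, m k ^ (-p⁻¹) * T i k with hη
  set ζ : n → ℝ := fun i =>
    ∑ j, d j ^ (-p⁻¹) * ‖((P : Matrix n n ℂ)ᴴ * (Q : Matrix n n ℂ)) i j‖ ^ 2 with hζ
  have hsumη : ∑ i, η i = ∑ k, m k ^ (-p⁻¹) := by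
    have h1 := trace_conjDiag_mul_conjDiag P R (fun _ => 1) (fun k => m k ^ (-p⁻¹))
    rw [conjDiag_one, one_mul, trace_conjDiag, Complex.ofReal_inj] at h1
    rw [h1]
    simp [hη, hT]
  -- The squared overlaps of two orthonormal bases form a doubly stochastic matrix.
  have hrow : ∀ a : n → ℝ, ∑ i, ∑ k, a i * T i k = ∑ i, a i := by
    intro a
    have h1 := trace_conjDiag_mul_conjDiag P R a (fun _ => 1)
    rw [conjDiag_one, mul_one, trace_conjDiag, Complex.ofReal_inj] at h1
    rw [h1]
    simp [hT]
  have hA := sum_div_le_of_conjDiag_add P Q R (y := fun k => (m k ^ (-p⁻¹)) ^ (1 - p))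
    (u := fun i => (c i + 1)⁻¹) hc hd hm (fun i => inv_mul_cancel₀ (hw i).ne')
    (fun k => (Real.rpow_pos_of_pos (hY k) _).le) h
  have hB := sum_rpow_mul_rpow_le_tangent P Q R hp0 hp1 (z := fun j => d j ^ (-p⁻¹))
    (y := fun k => m k ^ (-p⁻¹)) (κ := fun i => (c i + 1)⁻¹) (v := fun i => (c i + 1) ^ (-p⁻¹))
    (fun j => Real.rpow_pos_of_pos (hd j) _) hY hV
  have hC : ∑ i, ∑ k, c i * (c i + 1)⁻¹ ^ 2 * (m k ^ (-p⁻¹)) ^ (1 - p) * T i k ≤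
      ∑ i, (p * (c i * (c i + 1) ^ (-p⁻¹ - 1)) + (1 - p) * (c i * (c i + 1)⁻¹ * η i)) := by
    rw [Finset.sum_add_distrib, ← hrow (fun i => p * (c i * (c i + 1) ^ (-p⁻¹ - 1))),
      ← Finset.sum_add_distrib]
    refine Finset.sum_le_sum fun i _ => ?_
    simp only [hη]
    rw [Finset.mul_sum, Finset.mul_sum, ← Finset.sum_add_distrib]
    refine Finset.sum_le_sum fun k _ => ?_
    -- The scalar tangent bound, at each pair of eigenvalues of Y and V, is averaged with the
    -- nonnegative weights T i k.
    have h1 := rpow_one_sub_le_tangent hp0 hp1 (hY k) (hV i)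
    have h2 : 0 ≤ c i * (c i + 1)⁻¹ ^ 2 * T i k :=
      mul_nonneg (mul_nonneg (hc i) (sq_nonneg _)) (sq_nonneg _)
    refine le_of_eq_of_le (by ring) ((mul_le_mul_of_nonneg_left h1 h2).trans_eq ?_)
    rw [hpow1 _ (hw i), hpow' _ (hw i), hw1]
    have := (hw i).ne'
    field_simp
  have hB' : ∑ j, ∑ k, (d j)⁻¹ * (m k ^ (-p⁻¹)) ^ (1 - p) *
        ‖((Q : Matrix n n ℂ)ᴴ * conjDiag P (fun i => (c i + 1)⁻¹) * (R : Matrix n n ℂ)) j k‖ ^ 2 ≤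
      ∑ i, (p * ((c i + 1) ^ (-p⁻¹ - 1) * ζ i) + (1 - p) * ((c i + 1)⁻¹ * η i)) := by
    refine le_of_eq_of_le ?_ (hB.trans_eq ?_)
    · simp_rw [hpow _ (hd _)]
    · refine Finset.sum_congr rfl fun i _ => ?_
      rw [hpow1 _ (hw i), hpow' _ (hw i), hw1]
      have := (hw i).ne'
      simp only [hζ, hη, hT]
      field_simp
  have hL : ∑ k, (m k ^ (-p⁻¹)) ^ (1 - p) / m k = ∑ k, m k ^ (-p⁻¹) :=
    Finset.sum_congr rfl fun k _ => by
      rw [hpow1 _ (hm k), mul_div_assoc, div_self (hm k).ne', mul_one]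
  have htot := (hL.symm.le.trans hA).trans (add_le_add hC hB')
  rw [← Finset.sum_add_distrib] at htot
  -- The coefficients c/(c+1) and 1/(c+1) of η add up to 1, so the η terms sum to (1-p) Tr Y, which
  -- the left-hand side absorbs.
  have he : ∀ i, p * (c i * (c i + 1) ^ (-p⁻¹ - 1)) + (1 - p) * (c i * (c i + 1)⁻¹ * η i) +
      (p * ((c i + 1) ^ (-p⁻¹ - 1) * ζ i) + (1 - p) * ((c i + 1)⁻¹ * η i)) =
      p * ((c i + 1) ^ (-p⁻¹ - 1) * (c i + ζ i)) + (1 - p) * η i := by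
    intro i
    have h1 : (c i + 1) * (c i + 1)⁻¹ = 1 := mul_inv_cancel₀ (hw i).ne'
    linear_combination (1 - p) * η i * h1
  simp_rw [he] at htot
  rw [Finset.sum_add_distrib, ← Finset.mul_sum, ← Finset.mul_sum, hsumη] at htot
  refine le_of_mul_le_mul_left ?_ hp0
  linarith

end Matrix

/-! ### Translation to the deformed exponential -/

theorem theorem5p3 {n : Type*} [Fintype n] [DecidableEq n] (q : ℝ) (hq0 : 0 ≤ q) (hq1 : q < 1)
    (A B : Matrix n n ℂ) (hA : A.NegDef) (hB : B.NegDef) :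
    ((A + B).qExp q).trace ≤
      ((A.qExp q).realPow (2 - q) * (((q - 1 : ℝ) : ℂ) • A + B.qExp q)).trace := by
  have hAB : (A + B).NegDef := by
    have : (-A + -B).PosDef := Matrix.PosDef.add hA hB
    rwa [← neg_add] at this
  have hAs : IsSelfAdjoint A := by simpa using (Matrix.PosDef.isHermitian hA).isSelfAdjoint.neg
  obtain ⟨P, α, eA, hα, fA⟩ := hA.exists_cfc_eq_conjDiag
  obtain ⟨Q, β, eB, hβ, fB⟩ := hB.exists_cfc_eq_conjDiag
  obtain ⟨R, γ, eC, hγ, fC⟩ := hAB.exists_cfc_eq_conjDiag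
  have hp0 : 0 < 1 - q := by linarith
  have hexp : 1 / (q - 1) = -(1 - q)⁻¹ := by rw [one_div, ← inv_neg, neg_sub]
  have hq : ∀ x, qExp q x = ((q - 1) * x + 1) ^ (-(1 - q)⁻¹) := fun x => by
    rw [qExp, if_neg hq1.ne, hexp, mul_comm x]
  have hneg : ∀ x, x < 0 → 0 < (q - 1) * x := fun x hx =>
    mul_pos_of_neg_of_neg (by linarith) hx
  -- The shift by 1 is put into D and M but not into C, so that the two summands add up to the base
  -- of exp_q(A + B).
  have hsum : Matrix.conjDiag P (fun i => (q - 1) * α i) +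
      Matrix.conjDiag Q (fun i => (q - 1) * β i + 1) =
      Matrix.conjDiag R (fun i => (q - 1) * γ i + 1) := by
    rw [← Matrix.conjDiag_add Q, ← Matrix.conjDiag_add R, ← Matrix.conjDiag_smul,
      ← Matrix.conjDiag_smul, ← Matrix.conjDiag_smul, ← eA, ← eB, ← eC, Matrix.conjDiag_one,
      Matrix.conjDiag_one, smul_add, add_assoc]
  have hmain := Matrix.sum_rpow_le_of_conjDiag_add P Q R hp0 (by linarith)
    (fun i => (hneg _ (hα i)).le) (fun i => by linarith [hneg _ (hβ i)])
    (fun i => by linarith [hneg _ (hγ i)]) hsum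
  have hfin : (spectrum ℝ A).Finite := Matrix.finite_real_spectrum
  have hpow : (A.qExp q).realPow (2 - q) =
      Matrix.conjDiag P (fun i => ((q - 1) * α i + 1) ^ (-(1 - q)⁻¹ - 1)) := by
    rw [Matrix.realPow, Matrix.qExp, ← cfc_comp' (fun x : ℝ => x ^ (2 - q)) (qExp q) A
      ((hfin.image _).continuousOn _) (hfin.continuousOn _) hAs, fA]
    congr
    ext i
    have h0 : 0 ≤ (q - 1) * α i + 1 := by linarith [hneg _ (hα i)]
    -- The exponents agree because 2 - q = 1 + p, whence -(1/p)(1 + p) = -1/p - 1.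
    rw [hq, ← Real.rpow_mul h0]
    congr 1
    field_simp
    ring
  have hAq : ((q - 1 : ℝ) : ℂ) • A = Matrix.conjDiag P (fun i => (q - 1) * α i) := by
    rw [← Matrix.conjDiag_smul, ← eA]
  rw [hpow, hAq, Matrix.qExp, Matrix.qExp, fB, fC, mul_add, Matrix.conjDiag_mul,
    Matrix.trace_add, Matrix.trace_conjDiag, Matrix.trace_conjDiag,
    Matrix.trace_conjDiag_mul_conjDiag, ← Complex.ofReal_add, Complex.real_le_real]
  simp only [hq]
  refine hmain.trans_eq ?_
  rw [← Finset.sum_add_distrib]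
  refine Finset.sum_congr rfl fun i _ => ?_
  simp_rw [mul_add, Finset.mul_sum, mul_assoc]
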